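/- Let $W,V\colon\mathbb R\to[0,\infty)$. Assume that $W\in C^2(\mathbb R)$ is even, $W'$ and $W''$ are bounded, $W'\in L^1(\mathbb R)$ and $\inf W''=-C_W$ with $C_W>0$; and that $V(x)=\frac{\alpha}{2}x^2+\widetilde V(x)$ with $\alpha>0$, $\alpha+\inf\widetilde V''=C_V>0$ and $C_V-C_W>0$, where either $\widetilde V=0$, or $\widetilde V$ is even, of polynomial growth, and for some $J\ge 2$ one has $\widetilde V\in C^J(\mathbb R)\setminus C^{J+1}(\mathbb R)$ with $\widetilde V^{(j)}$ bounded for $2\le j\le J$. Let $\pi$ be an invariant density of the associated McKean–Vlasov equation, i.e. a probability density with $$\pi=Z_\pi^{-1}\exp(-2V-W\star\pi),\qquad Z_\pi=\int_{\mathbb R}\exp(-2V-W\star\pi)\,dx<\infty .$$ Write $\mathcal F(\varphi)(z)=\int_{\mathbb R}e^{\imath zx}\varphi(x)\,dx$ and $\mathcal L_a=\{y+\imath a:y\in\mathbb R\}$. Let $(a_j)$ be the zeros of $\mathcal F(\pi)$ in $\mathbb C$, with multiplicity, $\rho$ the order of $\mathcal F(\pi)$ (the infimum of the $m>0$ with $\mathcal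 F(\pi)(z)=O(\exp(|z|^m))$ as $z\to\infty$), and $\rho_1=\inf\{r>0:\sum_j|a_j|^{-r}<\infty\}$. A number $c_\pi>0$ and a family of positive numbers $(\epsilon_j)$ are called admissible if there is $K>0$ with $$|\mathcal F(\pi)(z)|\ge K\exp(-c_\pi|z|^2)\qquad\text{for all } z\in\mathbb C\setminus\bigcup_j B_{\epsilon_j}(a_j),$$ where $B_\epsilon(a)$ is the open disc of radius $\epsilon$ about $a$. (i) Admissible families exist: for every $\eta>0$ there is $c_\pi>0$ such that $c_\pi$ and $\epsilon_j=\eta|a_j|$ are admissible; and if $\rho_1<\rho$ or $\rho_1=\rho<2$, then for every real $\tau$ with $\rho_1<\tau\le 2$ there is $c_\pi>0$ such that $c_\pi$ and $\epsilon_j=|a_j|^{-\tau}$ are admissible. (ii) Let $c_\pi$ and $(\epsilon_j)$ be any admissible family such that $\bigcup_jB_{\epsilon_j}(a_j)$ does not meet the real line $\mathcal L_0$. Let $s\colon[0,\infty)\to(0,\infty)$ be slowly varying (measurable, with $s(\lambda t)/s(t)\to1$ as $t\to\infty$ for every $\lambda>0$) with $\liminf_{t\to\infty}s(t)>c_\pi$,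 and suppose that $|\mathcal F(W')(z)|=O(\exp(-|z|^2s(|z|)))$ as $|z|\to\infty$ on $\mathcal L_0$. Then $\mathcal F(\pi)$ has no zero on $\mathcal L_0$ and $$\int_{\mathcal L_0}\left|\frac{\mathcal F(W')(z)}{\mathcal F(\pi)(z)}\right|^2dz<\infty .$$ Consequently the condition "there is $\bar a\ge0$ such that $\mathcal F(W')$ and $\mathcal F(\pi)$ converge absolutely on $\mathcal L_{\pm\bar a}$ and $\int_{\mathcal L_{\pm\bar a}}|\mathcal F(W')(z)/\mathcal F(\pi)(z)|^2dz<\infty$" holds with $\bar a=0$. -/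

import Mathlib

open MeasureTheory Filter Topology Asymptotics
open scoped NNReal

namespace McKeanVlasov

noncomputable section

/-- The non-smooth alternative for the perturbation `U` of the quadratic confinement: `U` is even, of
polynomial growth, of class `C^J` but not `C^(J+1)` for some `J ≥ 2`, with bounded derivatives of
the orders `2, …, J`. -/
def IsRoughPerturbation (U : ℝ → ℝ) : Prop :=
  (∀ x, U (-x) = U x) ∧
  (∃ (n : ℕ) (C : ℝ), ∀ x, |U x| ≤ C * (1 + |x|) ^ n) ∧
  ∃ J : ℕ, 2 ≤ J ∧ ContDiff ℝ (J : ℕ∞) U ∧ ¬ ContDiff ℝ ((J + 1 : ℕ) : ℕ∞) U ∧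
    ∀ j : ℕ, 2 ≤ j → j ≤ J → ∃ C : ℝ, ∀ x, |iteratedDeriv j U x| ≤ C

/-- The standing hypotheses on the interaction potential `W` and on the confinement potential
`V x = α / 2 * x ^ 2 + U x`. -/
structure IsPotentialPair (W V U : ℝ → ℝ) (α CW CV : ℝ) : Prop where
  W_nonneg : ∀ x, 0 ≤ W x
  V_nonneg : ∀ x, 0 ≤ V x
  W_contDiff : ContDiff ℝ 2 W
  W_even : ∀ x, W (-x) = W x
  W_deriv_bounded : ∃ C : ℝ, ∀ x, |deriv W x| ≤ C
  W_deriv_integrable : Integrable (deriv W)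
  W_deriv2_bounded : ∃ C : ℝ, ∀ x, |iteratedDeriv 2 W x| ≤ C
  CW_pos : 0 < CW
  /-- `inf W'' = -CW` -/
  W_deriv2_inf : IsGLB (Set.range (iteratedDeriv 2 W)) (-CW)
  α_pos : 0 < α
  V_eq : ∀ x, V x = α / 2 * x ^ 2 + U x
  U_cases : (∀ x, U x = 0) ∨ IsRoughPerturbation U
  /-- `α + inf U'' = CV` -/
  U_deriv2_inf : IsGLB (Set.range (iteratedDeriv 2 U)) (CV - α)
  CV_pos : 0 < CV
  CV_gt_CW : 0 < CV - CW

/-- The unnormalised density `exp (- 2 V - W ⋆ p)`. -/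
def gibbsWeight (W V p : ℝ → ℝ) (x : ℝ) : ℝ :=
  Real.exp (-2 * V x - ∫ y, W (x - y) * p y)

/-- `p` is an invariant density of the McKean-Vlasov equation with potentials `W` and `V`: a
probability density with `p = Z⁻¹ exp (- 2 V - W ⋆ p)`, `Z = ∫ exp (- 2 V - W ⋆ p) < ∞`. -/
structure IsInvariantDensity (W V p : ℝ → ℝ) : Prop where
  nonneg : ∀ x, 0 ≤ p x
  integrable : Integrable p
  integral_eq_one : ∫ x, p x = 1
  weight_integrable : Integrable (gibbsWeight W V p)
  eq_gibbs : ∀ x, p x = (∫ y, gibbsWeight W V p y)⁻¹ * gibbsWeight W V p x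

/-- The Fourier transform on `ℂ`: `𝓕(φ)(z) = ∫ exp (i z x) φ(x) dx`. -/
def fourierC (φ : ℝ → ℝ) (z : ℂ) : ℂ :=
  ∫ x : ℝ, Complex.exp (Complex.I * z * (x : ℂ)) * ((φ x : ℝ) : ℂ)

/-- The line `{y + i a : y ∈ ℝ}`. -/
def horizontalLine (a : ℝ) : Set ℂ :=
  Set.range fun y : ℝ => (y : ℂ) + Complex.I * (a : ℂ)

/-- Indices of the zeros of an entire function, every zero occurring as often as its
multiplicity. -/
abbrev ZeroIndex (f : ℂ → ℂ) : Type :=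
  Σ a : {a : ℂ // f a = 0}, Fin (analyticOrderNatAt f (a : ℂ))

/-- The family `(a_j)` of the zeros of `f`, with multiplicity. -/
def zeroOf (f : ℂ → ℂ) (j : ZeroIndex f) : ℂ := (j.1 : ℂ)

/-- The order of an entire function: the infimum of the `m > 0` with `f(z) = O(exp (|z|^m))` as
`z → ∞`. -/
def growthOrder (f : ℂ → ℂ) : EReal :=
  sInf ((fun m : ℝ => (m : EReal)) ''
    {m : ℝ | 0 < m ∧ f =O[cocompact ℂ] fun z => Real.exp (‖z‖ ^ m)})

/-- The critical exponent of convergence of the zeros: the infimum of the `r > 0` with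
`∑ 1 / |a_j|^r < ∞`. -/
def convergenceExponent (f : ℂ → ℂ) : EReal :=
  sInf ((fun r : ℝ => (r : EReal)) ''
    {r : ℝ | 0 < r ∧ Summable fun j : ZeroIndex f => 1 / ‖zeroOf f j‖ ^ r})

/-- With `ρ` the order and `ρ₁` the critical exponent: `ρ₁ < ρ` or `ρ₁ = ρ < 2`. -/
def ExponentCondition (f : ℂ → ℂ) : Prop :=
  convergenceExponent f < growthOrder f ∨
    (convergenceExponent f = growthOrder f ∧ growthOrder f < 2)

/-- The union of the open discs of radius `ε j` about the zeros `a_j` of `f`. -/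
def zeroDiscs (f : ℂ → ℂ) (ε : ZeroIndex f → ℝ) : Set ℂ :=
  ⋃ j : ZeroIndex f, Metric.ball (zeroOf f j) (ε j)

/-- `c > 0` and the positive radii `ε` are such that `|f(z)| ≳ exp (- c |z|²)` outside the discs
of radius `ε j` about the zeros of `f`. -/
structure GaussianLowerBound (f : ℂ → ℂ) (c : ℝ) (ε : ZeroIndex f → ℝ) : Prop where
  c_pos : 0 < c
  radius_pos : ∀ j, 0 < ε j
  bound : ∃ K : ℝ, 0 < K ∧ ∀ z : ℂ, z ∉ zeroDiscs f ε → K * Real.exp (-c * ‖z‖ ^ 2) ≤ ‖f z‖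

/-- Slowly varying functions on `[0, ∞)`. -/
structure IsSlowlyVarying (s : ℝ≥0 → ℝ) : Prop where
  pos : ∀ t, 0 < s t
  measurable : Measurable s
  ratio_tendsto : ∀ l : ℝ≥0, 0 < l → Tendsto (fun t => s (l * t) / s t) atTop (𝓝 1)

/-- `∫ |f(z) / g(z)|² dz < ∞` over the line `{y + i a : y ∈ ℝ}`, where the quotient is defined
almost everywhere on the line. -/
def QuotientSquareIntegrableOn (f g : ℂ → ℂ) (a : ℝ) : Prop :=
  (∀ᵐ y : ℝ, g ((y : ℂ) + Complex.I * (a : ℂ)) ≠ 0) ∧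
  Integrable fun y : ℝ =>
    ‖f ((y : ℂ) + Complex.I * (a : ℂ)) / g ((y : ℂ) + Complex.I * (a : ℂ))‖ ^ 2

/-- The transforms of `W'` and `p` satisfy `∫ |𝓕(W')(z) / 𝓕(p)(z)|² dz < ∞` over both lines
`{y ± i a : y ∈ ℝ}`, on which they are given by convergent integrals. -/
structure TransformCondition (W p : ℝ → ℝ) (a : ℝ) : Prop where
  nonneg : 0 ≤ a
  converges : ∀ z ∈ horizontalLine a ∪ horizontalLine (-a),
    Integrable (fun x : ℝ => Complex.exp (Complex.I * z * (x : ℂ)) * ((deriv W x : ℝ) : ℂ)) ∧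
    Integrable (fun x : ℝ => Complex.exp (Complex.I * z * (x : ℂ)) * ((p x : ℝ) : ℂ))
  upper : QuotientSquareIntegrableOn (fourierC (deriv W)) (fourierC p) a
  lower : QuotientSquareIntegrableOn (fourierC (deriv W)) (fourierC p) (-a)

end

end McKeanVlasov

open McKeanVlasov

/-! Write `F = fourierC p`. Since `U'' ≥ CV - α`, the potential `V` lies above a parabola, and `W ⋆
p ≥ 0`, so `p` has Gaussian tails. Completing the square makes `F` entire with `|F z| ≤ exp (A |z|²
+ B)`, and `F 0 = 1`.

Part (i) is a minimum modulus estimate (`card_zeros_le_and_prod_le_norm`). Dividing out the zeros of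
modulus at most `2R` leaves a function that is zero-free on `|z| < 2R`; Borel–Carathéodory, applied
to its logarithm, bounds it below by `exp (-O(R²))` on `|z| ≤ R`. Outside discs of radius at least
`|a| exp (-L a)`, each factor `|1 - z/a|` is at least `exp (-L a)`, so a Gaussian bound follows once
the sum of `L` over these zeros is `O(R²)` (`exists_gaussianLowerBound`). For radii `η|a|` this is
the zero count; for `|a|^(-τ)` it is the convergence of `∑ |a|^(-r)` for some `r < τ`.

In part (ii) the discs miss the real line, so the lower bound holds on all of it, and the numerator
decays with a strictly larger Gaussian rate (`quotientSquareIntegrableOn_zero`). -/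

namespace McKeanVlasov

/-! ### Logarithms of zero-free functions and division by zeros. -/

/-- A zero-free holomorphic function on a disc, normalised at the centre and bounded above, is
bounded below on the disc of half the radius. -/
theorem exp_neg_le_norm_of_ne_zero {g : ℂ → ℂ} {R M : ℝ} (hR : 0 < R) (hM : 0 < M)
    (hg : Differentiable ℂ g) (h0 : g 0 = 1) (hne : ∀ z, ‖z‖ < 2 * R → g z ≠ 0)
    (hb : ∀ z, ‖z‖ < 2 * R → ‖g z‖ ≤ Real.exp M) {z : ℂ} (hz : ‖z‖ ≤ R) :
    Real.exp (-(2 * M)) ≤ ‖g z‖ := by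
  have hg' : Differentiable ℂ (deriv g) := fun w =>
    ((hg.analyticAt w).deriv).differentiableAt
  have hq : DifferentiableOn ℂ (fun w => deriv g w / g w) (Metric.ball 0 (2 * R)) :=
    hg'.differentiableOn.div hg.differentiableOn fun w hw => hne w (by simpa using hw)
  -- The primitive of `g'/g` vanishing at `0` is the logarithm of `g`: `g * exp (-h)` has zero
  -- derivative and equals `1` at `0`.
  obtain ⟨h, h00, hh⟩ := hq.isExactOn_ball.with_val_at 0 0
  have hlog : ∀ w ∈ Metric.ball (0 : ℂ) (2 * R), g w = Complex.exp (h w) := by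
    have hder : ∀ w ∈ Metric.ball (0 : ℂ) (2 * R),
        HasDerivAt (fun w => g w * Complex.exp (-h w)) 0 w := by
      intro w hw
      have hnw : g w ≠ 0 := hne w (by simpa using hw)
      have hval : deriv g w * Complex.exp (-h w) +
          g w * (Complex.exp (-h w) * -(deriv g w / g w)) = 0 := by
        field_simp
        ring
      have hd := (hg w).hasDerivAt.mul ((hh w hw).neg.cexp)
      simp only [Pi.neg_apply, hval] at hd
      exact hd
    intro w hw
    have hc := (convex_ball (0 : ℂ) (2 * R)).norm_image_sub_le_of_norm_hasDerivWithin_le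
      (C := 0) (fun w hw => (hder w hw).hasDerivWithinAt) (by simp)
      (Metric.mem_ball_self (by positivity)) hw
    simp only [h0, h00, neg_zero, Complex.exp_zero, mul_one, zero_mul, norm_le_zero_iff,
      sub_eq_zero] at hc
    rw [Complex.exp_neg] at hc
    field_simp at hc
    exact hc
  have hz' : z ∈ Metric.ball (0 : ℂ) (2 * R) := by simpa using (by linarith : ‖z‖ < 2 * R)
  -- The upper bound on `|g|` reads `Re h ≤ M`; Borel–Carathéodory turns it into a bound on `|h|`,
  -- hence on `-Re h`.
  have hBC := Complex.borelCaratheodory_zero hM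
    (fun w hw => (hh w hw).differentiableAt.differentiableWithinAt)
    (fun w hw => by
      have := hb w (by simpa using hw)
      rw [hlog w hw, Complex.norm_exp, Real.exp_le_exp] at this
      exact this) (by positivity) hz' h00
  have h2 : 2 * M * ‖z‖ / (2 * R - ‖z‖) ≤ 2 * M := by
    rw [div_le_iff₀ (by linarith)]
    nlinarith
  rw [hlog z hz', Complex.norm_exp, Real.exp_le_exp]
  linarith [Complex.abs_re_le_norm (h z), neg_abs_le (h z).re]

/-- An entire function is divisible by `(z - b) ^ n` if it vanishes to order `n` at `b`. -/
theorem exists_eq_sub_pow_mul {f : ℂ → ℂ} (hf : Differentiable ℂ f) (b : ℂ) (n : ℕ)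
    (hn : (n : ℕ∞) ≤ analyticOrderAt f b) :
    ∃ h : ℂ → ℂ, Differentiable ℂ h ∧ ∀ z, f z = (z - b) ^ n * h z := by
  induction n with
  | zero => exact ⟨f, hf, by simp⟩
  | succ n ih =>
    obtain ⟨h, hh, hfh⟩ := ih (le_trans (by exact_mod_cast n.le_succ) hn)
    have hb : h b = 0 := by
      by_contra hb
      have := (hf.analyticAt b).analyticOrderAt_eq_natCast (n := n) |>.2
        ⟨h, hh.analyticAt b, hb, Eventually.of_forall fun z => by simp [hfh z]⟩
      rw [this] at hn
      have : n + 1 ≤ n := by exact_mod_cast hn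
      omega
    refine ⟨dslope h b, ?_, fun z => ?_⟩
    · have := (Complex.differentiableOn_dslope (f := h) (c := b) (s := Set.univ) univ_mem).2
        hh.differentiableOn
      exact differentiableOn_univ.1 this
    · have := sub_smul_dslope h b z
      rw [hb, sub_zero, smul_eq_mul] at this
      rw [hfh z, ← this]
      ring

/-- If the cofactor vanished at `b`, one more factor would split off and exceed the order. The
factor `1 - z / b` is `1` at the origin, so the cofactor keeps the value of `f` there. -/
theorem exists_eq_one_sub_div_pow_mul {f : ℂ → ℂ} (hf : Differentiable ℂ f) {b : ℂ} (hb : b ≠ 0)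
    (hord : analyticOrderAt f b ≠ ⊤) :
    ∃ h : ℂ → ℂ, Differentiable ℂ h ∧ h b ≠ 0 ∧
      ∀ z, f z = (1 - z / b) ^ analyticOrderNatAt f b * h z := by
  obtain ⟨h, hh, hfh⟩ := exists_eq_sub_pow_mul hf b (analyticOrderNatAt f b)
    (Nat.cast_analyticOrderNatAt hord).le
  refine ⟨fun z => (-b) ^ analyticOrderNatAt f b * h z, hh.const_mul _, ?_, fun z => ?_⟩
  · refine mul_ne_zero (pow_ne_zero _ (neg_ne_zero.2 hb)) fun hb0 => ?_
    obtain ⟨k, hk, hhk⟩ := exists_eq_sub_pow_mul hh b 1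
      (by
        rw [Nat.cast_one, Order.one_le_iff_ne_zero]
        exact ((hh.analyticAt b).analyticOrderAt_ne_zero).2 hb0)
    have : ((analyticOrderNatAt f b + 1 : ℕ) : ℕ∞) ≤ analyticOrderAt f b :=
      (natCast_le_analyticOrderAt (hf.analyticAt b)).2
        ⟨k, hk.analyticAt b, Eventually.of_forall fun z => by
          rw [hfh, hhk, smul_eq_mul]; ring⟩
    rw [← Nat.cast_analyticOrderNatAt hord] at this
    have : analyticOrderNatAt f b + 1 ≤ analyticOrderNatAt f b := by exact_mod_cast this
    omega
  · rw [hfh z, ← mul_assoc, ← mul_pow]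
    congr 2
    field_simp
    ring

theorem analyticOrderAt_ne_top_of_apply_ne_zero {f : ℂ → ℂ} (hf : Differentiable ℂ f) {w : ℂ}
    (hw : f w ≠ 0) (b : ℂ) : analyticOrderAt f b ≠ ⊤ := fun h =>
  hw (congrFun ((AnalyticOnNhd.analyticOrderAt_eq_top_iff_eq_zero b hf.analyticAt).1 h) w)

/-- Finitely many zeros, none of them `0`, can be divided out of an entire function. -/
theorem exists_eq_prod_mul {f : ℂ → ℂ} (hf : Differentiable ℂ f) {w : ℂ} (hw : f w ≠ 0)
    (S : Finset ℂ) (hS : ∀ b ∈ S, b ≠ 0) :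
    ∃ g : ℂ → ℂ, Differentiable ℂ g ∧ (∀ b ∈ S, g b ≠ 0) ∧
      ∀ z, f z = (∏ b ∈ S, (1 - z / b) ^ analyticOrderNatAt f b) * g z := by
  classical
  induction S using Finset.induction_on with
  | empty => exact ⟨f, hf, by simp, by simp⟩
  | insert b S hbS ih =>
    obtain ⟨g, hg, hgS, hfg⟩ := ih fun a ha => hS a (Finset.mem_insert_of_mem ha)
    have hb := hS b (Finset.mem_insert_self b S)
    have hP : Differentiable ℂ fun z => ∏ a ∈ S, (1 - z / a) ^ analyticOrderNatAt f a := by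
      fun_prop
    have hPb : ∏ a ∈ S, (1 - b / a) ^ analyticOrderNatAt f a ≠ 0 := by
      refine Finset.prod_ne_zero_iff.2 fun a ha => pow_ne_zero _ fun h => hbS ?_
      have ha0 := hS a (Finset.mem_insert_of_mem ha)
      rw [sub_eq_zero, eq_div_iff ha0, one_mul] at h
      exact h ▸ ha
    -- The factors already removed do not vanish at `b`.
    have hord : analyticOrderAt f b = analyticOrderAt g b := by
      have hfe : f = (fun z => ∏ a ∈ S, (1 - z / a) ^ analyticOrderNatAt f a) * g := by
        ext z
        exact hfg z
      conv_lhs => rw [hfe]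
      rw [analyticOrderAt_mul (hP.analyticAt b) (hg.analyticAt b),
        (hP.analyticAt b).analyticOrderAt_eq_zero.2 hPb, zero_add]
    have hgw : g w ≠ 0 := fun h => hw (by rw [hfg w, h, mul_zero])
    obtain ⟨h, hh, hhb, hgh⟩ := exists_eq_one_sub_div_pow_mul hg hb
      (analyticOrderAt_ne_top_of_apply_ne_zero hg hgw b)
    refine ⟨h, hh, fun a ha => ?_, fun z => ?_⟩
    · rcases Finset.mem_insert.1 ha with rfl | ha
      · exact hhb
      · intro h0
        exact hgS a ha (by rw [hgh a, h0, mul_zero])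
    · rw [Finset.prod_insert hbS, hfg z, hgh z, analyticOrderNatAt, analyticOrderNatAt, hord]
      ring

/-! ### Minimum modulus and lower bounds outside discs. -/

theorem finite_zeros_of_isCompact {f : ℂ → ℂ} (hf : Differentiable ℂ f) {w : ℂ} (hw : f w ≠ 0)
    {K : Set ℂ} (hK : IsCompact K) : {z | z ∈ K ∧ f z = 0}.Finite := by
  by_contra hinf
  obtain ⟨x, -, hx⟩ := Set.Infinite.exists_accPt_of_subset_isCompact hinf hK fun z hz => hz.1
  have hfr : ∃ᶠ z in 𝓝[≠] x, f z = 0 :=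
    (accPt_iff_frequently_nhdsNE.1 hx).mono fun z hz => hz.2
  exact hw (AnalyticOnNhd.eqOn_zero_of_preconnected_of_frequently_eq_zero (fun z _ => hf.analyticAt z)
    isPreconnected_univ (Set.mem_univ x) hfr (Set.mem_univ w))

theorem exists_finset_zeros {f : ℂ → ℂ} (hf : Differentiable ℂ f) {w : ℂ} (hw : f w ≠ 0) (r : ℝ) :
    ∃ T : Finset {a : ℂ // f a = 0}, ∀ a, a ∈ T ↔ ‖(a : ℂ)‖ ≤ r := by
  have hfin : {a : {a : ℂ // f a = 0} | ‖(a : ℂ)‖ ≤ r}.Finite :=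
    Set.Finite.of_finite_image (f := Subtype.val)
      ((finite_zeros_of_isCompact hf hw (isCompact_closedBall (0 : ℂ) r)).subset (by
        rintro _ ⟨a, ha, rfl⟩
        exact ⟨by simpa using ha, a.2⟩)) Subtype.val_injective.injOn
  exact ⟨hfin.toFinset, fun a => by simp⟩

/-- Minimum modulus estimate for an entire function of order two and finite type: a bound for the
number of zeros, and a lower bound by the product over the zeros of modulus at most `2 * R`. -/
theorem card_zeros_le_and_prod_le_norm {f : ℂ → ℂ} (hf : Differentiable ℂ f) (h0 : f 0 = 1)
    {A B : ℝ} (hA : 0 < A) (hfb : ∀ z, ‖f z‖ ≤ Real.exp (A * ‖z‖ ^ 2 + B)) {R : ℝ} (hR : 0 < R)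
    (T : Finset {a : ℂ // f a = 0}) (hT : ∀ a, a ∈ T ↔ ‖(a : ℂ)‖ ≤ 2 * R) :
    (∑ a ∈ T, (analyticOrderNatAt f a : ℝ)) ≤ A * (8 * R) ^ 2 + B ∧
    ∀ z, ‖z‖ ≤ R → Real.exp (-(2 * (A * (8 * R) ^ 2 + B))) *
      ∏ a ∈ T, ‖1 - z / (a : ℂ)‖ ^ analyticOrderNatAt f a ≤ ‖f z‖ := by
  classical
  have hw : f 0 ≠ 0 := by simp [h0]
  have hB : 0 ≤ B := by simpa [h0] using hfb 0
  have hane : ∀ a : {a : ℂ // f a = 0}, (a : ℂ) ≠ 0 := fun a ha => hw (by simpa only [ha] using a.2)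
  obtain ⟨g, hg, hgS, hfg⟩ := exists_eq_prod_mul hf hw (T.image Subtype.val) (by
    intro b hb
    obtain ⟨a, -, rfl⟩ := Finset.mem_image.1 hb
    exact hane a)
  simp only [Finset.prod_image Subtype.val_injective.injOn] at hfg
  set M := A * (8 * R) ^ 2 + B with hMdef
  have hM : 0 < M := by positivity
  set N := ∑ a ∈ T, analyticOrderNatAt f a with hN
  have hfr : ∀ z ∈ frontier (Metric.ball (0 : ℂ) (8 * R)), ‖g z‖ ≤ Real.exp (M - N) := by
    intro z hz
    rw [frontier_ball _ (by positivity), mem_sphere_zero_iff_norm] at hz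
    have hP : Real.exp N ≤ ‖∏ a ∈ T, (1 - z / a) ^ analyticOrderNatAt f a‖ := by
      -- This is the reason for the radius `8 * R`: `|z / a| ≥ 4` gives `|1 - z / a| ≥ 3 > e`, so
      -- each zero gains a factor `e`.
      have hfac : ∀ a ∈ T, Real.exp 1 ≤ ‖1 - z / (a : ℂ)‖ := by
        intro a ha
        have h1 : 4 ≤ ‖z / (a : ℂ)‖ := by
          rw [norm_div, le_div_iff₀ (norm_pos_iff.2 (hane a)), hz]
          linarith [(hT a).1 ha]
        have h2 := norm_sub_norm_le (z / (a : ℂ)) 1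
        rw [norm_sub_rev, norm_one] at h2
        linarith [Real.exp_one_lt_d9]
      rw [norm_prod]
      calc Real.exp N = ∏ a ∈ T, Real.exp 1 ^ analyticOrderNatAt f a := by
            rw [Finset.prod_pow_eq_pow_sum, ← hN, ← Real.exp_nat_mul, mul_one]
        _ ≤ _ := by
            refine Finset.prod_le_prod (fun _ _ => by positivity) fun a ha => ?_
            rw [norm_pow]
            exact pow_le_pow_left₀ (Real.exp_pos _).le (hfac a ha) _
    have h3 := hfb z
    rw [hfg z, norm_mul, hz, ← hMdef] at h3
    rw [Real.exp_sub, le_div_iff₀ (Real.exp_pos _), mul_comm]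
    exact (mul_le_mul_of_nonneg_right hP (norm_nonneg _)).trans h3
  have hgb : ∀ z, ‖z‖ ≤ 8 * R → ‖g z‖ ≤ Real.exp (M - N) := fun z hz =>
    Complex.norm_le_of_forall_mem_frontier_norm_le Metric.isBounded_ball hg.diffContOnCl hfr
      (by rw [closure_ball _ (by positivity)]; simpa using hz)
  have hg0 : g 0 = 1 := by simpa [h0] using (hfg 0).symm
  -- Jensen-type count: `1 = |g 0| ≤ exp (M - N)`.
  have hNM : (N : ℝ) ≤ M := by
    have := hgb 0 (by simp; positivity)
    rw [hg0, norm_one, Real.one_le_exp_iff] at this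
    linarith
  refine ⟨by rw [← Nat.cast_sum]; exact hNM, fun z hz => ?_⟩
  have hlow := exp_neg_le_norm_of_ne_zero hR hM hg hg0
    (fun w hwR hgw => by
      have hfw : f w = 0 := by rw [hfg w, hgw, mul_zero]
      exact hgS w (Finset.mem_image.2 ⟨⟨w, hfw⟩, (hT _).2 hwR.le, rfl⟩) hgw)
    (fun w hwR => (hgb w (by linarith)).trans
      (Real.exp_le_exp.2 (by linarith [Nat.cast_nonneg (α := ℝ) N]))) hz
  rw [hfg z, norm_mul, norm_prod, mul_comm]
  simp only [norm_pow]
  gcongr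

/-- Ensures that every zero occurs in `ZeroIndex f`, hence is the centre of some disc. -/
theorem analyticOrderNatAt_pos {f : ℂ → ℂ} (hf : Differentiable ℂ f) {w : ℂ} (hw : f w ≠ 0)
    {a : ℂ} (ha : f a = 0) : 0 < analyticOrderNatAt f a := by
  rw [Nat.pos_iff_ne_zero]
  intro h
  have h1 := Nat.cast_analyticOrderNatAt (analyticOrderAt_ne_top_of_apply_ne_zero hf hw a)
  rw [h, Nat.cast_zero, eq_comm, (hf.analyticAt a).analyticOrderAt_eq_zero] at h1
  exact h1 ha

/-- A Gaussian lower bound holds outside discs whose relative radii are at least `exp (-L a)`, if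
the sum of `L` over the zeros of modulus at most `2 * R` is of order `R ^ 2`. -/
theorem exists_gaussianLowerBound {f : ℂ → ℂ} (hf : Differentiable ℂ f) (h0 : f 0 = 1)
    {A B : ℝ} (hA : 0 < A) (hfb : ∀ z, ‖f z‖ ≤ Real.exp (A * ‖z‖ ^ 2 + B))
    (e L : {a : ℂ // f a = 0} → ℝ) (hL : ∀ a, Real.exp (-L a) * ‖(a : ℂ)‖ ≤ e a) {D : ℝ}
    (hD : 0 ≤ D) (hsum : ∀ R : ℝ, 1 ≤ R → ∀ T : Finset {a : ℂ // f a = 0},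
      (∀ a, a ∈ T ↔ ‖(a : ℂ)‖ ≤ 2 * R) → ∑ a ∈ T, analyticOrderNatAt f a * L a ≤ D * R ^ 2) :
    ∃ c, GaussianLowerBound f c fun j => e j.1 := by
  have hw : f 0 ≠ 0 := by simp [h0]
  have hB : 0 ≤ B := by simpa [h0] using hfb 0
  have hane : ∀ a : {a : ℂ // f a = 0}, 0 < ‖(a : ℂ)‖ :=
    fun a => norm_pos_iff.2 fun ha => hw (by simpa only [ha] using a.2)
  -- The minimum modulus estimate costs `2 * (A * 64 + B)` per `R ^ 2`, with `64 = 8 ^ 2`, and the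
  -- discs cost `D`. The `1` in `R ^ 2 ≤ 1 + ‖z‖ ^ 2` goes into the prefactor `exp (-c)`.
  set c := 2 * (A * 64 + B) + D with hc
  have hcpos : 0 < c := by positivity
  refine ⟨c, hcpos, fun j => lt_of_lt_of_le (mul_pos (Real.exp_pos _) (hane j.1)) (hL j.1),
    Real.exp (-c), Real.exp_pos _, fun z hz => ?_⟩
  set R := max 1 ‖z‖ with hRdef
  have hR1 : 1 ≤ R := le_max_left _ _
  have hRsq : R ^ 2 ≤ 1 + ‖z‖ ^ 2 := by
    rcases max_choice 1 ‖z‖ with h | h <;> rw [hRdef, h] <;> nlinarith [sq_nonneg ‖z‖]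
  obtain ⟨T, hT⟩ := exists_finset_zeros hf hw (2 * R)
  have hmain := (card_zeros_le_and_prod_le_norm hf h0 hA hfb (by linarith) T hT).2 z
    (le_max_right _ _)
  have hprod : Real.exp (-(D * R ^ 2)) ≤ ∏ a ∈ T, ‖1 - z / (a : ℂ)‖ ^ analyticOrderNatAt f a := by
    calc Real.exp (-(D * R ^ 2))
        ≤ Real.exp (∑ a ∈ T, analyticOrderNatAt f a * (-L a)) := by
          refine Real.exp_le_exp.2 ?_
          simp only [mul_neg, Finset.sum_neg_distrib]
          linarith [hsum R hR1 T hT]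
      _ = ∏ a ∈ T, Real.exp (-L a) ^ analyticOrderNatAt f a := by
          rw [Real.exp_sum]
          exact Finset.prod_congr rfl fun a _ => Real.exp_nat_mul _ _
      _ ≤ _ := by
          refine Finset.prod_le_prod (fun _ _ => by positivity) fun a _ => ?_
          refine pow_le_pow_left₀ (Real.exp_pos _).le ?_ _
          have hz' : e a ≤ ‖z - a‖ := by
            by_contra hlt
            refine hz (Set.mem_iUnion.2
              ⟨⟨a, ⟨0, analyticOrderNatAt_pos hf hw a.2⟩⟩, ?_⟩)
            rw [Metric.mem_ball, dist_eq_norm]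
            exact not_le.1 hlt
          have ha0 : (a : ℂ) ≠ 0 := norm_pos_iff.1 (hane a)
          have heq : ‖1 - z / (a : ℂ)‖ = ‖z - a‖ / ‖(a : ℂ)‖ := by
            rw [one_sub_div ha0, norm_div, norm_sub_rev]
          rw [heq, le_div_iff₀ (hane a)]
          exact (hL a).trans hz'
  calc Real.exp (-c) * Real.exp (-c * ‖z‖ ^ 2)
      ≤ Real.exp (-(2 * (A * (8 * R) ^ 2 + B))) * Real.exp (-(D * R ^ 2)) := by
        rw [← Real.exp_add, ← Real.exp_add]
        refine Real.exp_le_exp.2 ?_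
        have h1 : 2 * (A * (8 * R) ^ 2 + B) + D * R ^ 2 ≤ c * R ^ 2 := by
          rw [hc]
          nlinarith [mul_le_mul_of_nonneg_left (one_le_pow₀ hR1 : 1 ≤ R ^ 2) hB]
        nlinarith
    _ ≤ _ := (mul_le_mul_of_nonneg_left hprod (Real.exp_pos _).le).trans hmain

theorem exists_gaussianLowerBound_const_mul_norm {f : ℂ → ℂ} (hf : Differentiable ℂ f)
    (h0 : f 0 = 1) {A B : ℝ} (hA : 0 < A) (hfb : ∀ z, ‖f z‖ ≤ Real.exp (A * ‖z‖ ^ 2 + B))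
    {η : ℝ} (hη : 0 < η) : ∃ c, GaussianLowerBound f c fun j => η * ‖zeroOf f j‖ := by
  have hB : 0 ≤ B := by simpa [h0] using hfb 0
  refine exists_gaussianLowerBound hf h0 hA hfb (fun a => η * ‖(a : ℂ)‖) (fun _ => |Real.log η|)
    (fun a => ?_) (D := (A * 64 + B) * |Real.log η|) (by positivity) fun R hR T hT => ?_
  · refine mul_le_mul_of_nonneg_right ?_ (norm_nonneg _)
    calc Real.exp (-|Real.log η|) ≤ Real.exp (Real.log η) :=
          Real.exp_le_exp.2 (neg_abs_le _)
      _ = η := Real.exp_log hη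
  · rw [← Finset.sum_mul]
    have hn := (card_zeros_le_and_prod_le_norm hf h0 hA hfb (by linarith) T hT).1
    have h1 : A * (8 * R) ^ 2 + B ≤ (A * 64 + B) * R ^ 2 := by
      nlinarith [mul_le_mul_of_nonneg_left (one_le_pow₀ hR : 1 ≤ R ^ 2) hB]
    calc _ ≤ ((A * 64 + B) * R ^ 2) * |Real.log η| :=
          mul_le_mul_of_nonneg_right (hn.trans h1) (abs_nonneg _)
      _ = _ := by ring

theorem exists_gaussianLowerBound_rpow_norm {f : ℂ → ℂ} (hf : Differentiable ℂ f)
    (h0 : f 0 = 1) {A B : ℝ} (hA : 0 < A) (hfb : ∀ z, ‖f z‖ ≤ Real.exp (A * ‖z‖ ^ 2 + B))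
    {τ : ℝ} (hτ : convergenceExponent f < (τ : EReal)) (hτ2 : τ ≤ 2) :
    ∃ c, GaussianLowerBound f c fun j => 1 / ‖zeroOf f j‖ ^ τ := by
  classical
  have hw : f 0 ≠ 0 := by simp [h0]
  have hane : ∀ a : {a : ℂ // f a = 0}, 0 < ‖(a : ℂ)‖ :=
    fun a => norm_pos_iff.2 fun ha => hw (by simpa only [ha] using a.2)
  obtain ⟨_, ⟨r, ⟨hr0, hr⟩, rfl⟩, hrτ⟩ := sInf_lt_iff.1 hτ
  have hrτ : r < τ := EReal.coe_lt_coe_iff.1 hrτ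
  have hδ : 0 < 2 - r := by linarith
  set S := ∑' j : ZeroIndex f, 1 / ‖zeroOf f j‖ ^ r with hS
  have hSnn : 0 ≤ S := tsum_nonneg fun j => by positivity
  have hκ : 0 ≤ (1 + τ) / (2 - r) := div_nonneg (by linarith) hδ.le
  refine exists_gaussianLowerBound hf h0 hA hfb (fun a => 1 / ‖(a : ℂ)‖ ^ τ)
    (fun a => (1 + τ) / (2 - r) * ‖(a : ℂ)‖ ^ (2 - r))
    (fun a => ?_) (D := (1 + τ) / (2 - r) * (4 * S)) (by positivity) fun R hR T hT => ?_
  -- The radius is `|a| * exp (-(1 + τ) log |a|)`, and `log t ≤ t ^ (2 - r) / (2 - r)`.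
  · have hlog := Real.log_le_rpow_div (hane a).le hδ
    rw [le_div_iff₀ (Real.rpow_pos_of_pos (hane a) _), mul_assoc]
    have : ‖(a : ℂ)‖ * ‖(a : ℂ)‖ ^ τ = Real.exp (Real.log ‖(a : ℂ)‖ * (1 + τ)) := by
      rw [← Real.rpow_def_of_pos (hane a), Real.rpow_add (hane a), Real.rpow_one]
    rw [this, ← Real.exp_add, Real.exp_le_one_iff]
    have h2 := mul_le_mul_of_nonneg_right hlog (by linarith : 0 ≤ 1 + τ)
    have h3 : ‖(a : ℂ)‖ ^ (2 - r) / (2 - r) * (1 + τ) =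
      (1 + τ) / (2 - r) * ‖(a : ℂ)‖ ^ (2 - r) := by ring
    linarith
  · have hsum : ∑ a ∈ T, (analyticOrderNatAt f a : ℝ) * (1 / ‖(a : ℂ)‖ ^ r) ≤ S := by
      have := hr.sum_le_tsum (T.sigma fun a => Finset.univ) fun j _ => by positivity
      rw [Finset.sum_sigma] at this
      simpa [hS, zeroOf] using this
    have hterm : ∀ a ∈ T, (analyticOrderNatAt f a : ℝ) *
        ((1 + τ) / (2 - r) * ‖(a : ℂ)‖ ^ (2 - r)) ≤
        (1 + τ) / (2 - r) * (4 * R ^ 2) *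
          ((analyticOrderNatAt f a : ℝ) * (1 / ‖(a : ℂ)‖ ^ r)) := by
      intro a ha
      -- From `|a| ≤ 2 * R`: trading `|a| ^ 2` for `4 * R ^ 2` leaves the summable `|a| ^ (-r)`.
      have h1 : ‖(a : ℂ)‖ ^ (2 - r) ≤ 4 * R ^ 2 * (1 / ‖(a : ℂ)‖ ^ r) := by
        rw [Real.rpow_sub (hane a), Real.rpow_two, mul_one_div]
        gcongr
        nlinarith [(hT a).1 ha, norm_nonneg (a : ℂ)]
      calc _ = (1 + τ) / (2 - r) * ((analyticOrderNatAt f a : ℝ) * ‖(a : ℂ)‖ ^ (2 - r)) := by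
            ring
        _ ≤ (1 + τ) / (2 - r) *
            ((analyticOrderNatAt f a : ℝ) * (4 * R ^ 2 * (1 / ‖(a : ℂ)‖ ^ r))) := by gcongr
        _ = _ := by ring
    calc _ ≤ _ := Finset.sum_le_sum hterm
      _ = (1 + τ) / (2 - r) * (4 * R ^ 2) *
          ∑ a ∈ T, (analyticOrderNatAt f a : ℝ) * (1 / ‖(a : ℂ)‖ ^ r) := by
            rw [Finset.mul_sum]
      _ ≤ (1 + τ) / (2 - r) * (4 * R ^ 2) * S := by gcongr
      _ = _ := by ring

/-! ### Gaussian tails of invariant densities. -/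

theorem IsPotentialPair.contDiff_two {W V U : ℝ → ℝ} {α CW CV : ℝ}
    (h : IsPotentialPair W V U α CW CV) : ContDiff ℝ 2 U := by
  rcases h.U_cases with h0 | ⟨-, -, J, hJ, hU, -⟩
  · rw [show U = fun _ => 0 from funext h0]
    exact contDiff_const
  · exact hU.of_le (WithTop.coe_le_coe.2 (by exact_mod_cast hJ : ((2 : ℕ) : ℕ∞) ≤ J))

/-- The confinement potential lies above a parabola. -/
theorem IsPotentialPair.exists_le_V {W V U : ℝ → ℝ} {α CW CV : ℝ}
    (h : IsPotentialPair W V U α CW CV) :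
    ∃ b d : ℝ, ∀ x, CV / 2 * x ^ 2 + b * x + d ≤ V x := by
  have hU := h.contDiff_two
  have hUd : Differentiable ℝ U := hU.differentiable (by norm_num)
  have hUd' : Differentiable ℝ (deriv U) := by
    have : ContDiff ℝ ((1 : ℕ∞) + 1) U := by
      convert hU using 1
      norm_num
    exact ((contDiff_succ_iff_deriv.1 this).2.2).differentiable (by norm_num)
  -- `f` is `V` minus `CV / 2 * x ^ 2`; it is convex and so lies above its tangent at `0`.
  set f : ℝ → ℝ := fun x => U x + (α - CV) / 2 * x ^ 2 with hf
  have hd1 : ∀ x, HasDerivAt f (deriv U x + (α - CV) * x) x := fun x => by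
    refine ((hUd x).hasDerivAt.add ((hasDerivAt_pow 2 x).const_mul ((α - CV) / 2))).congr_deriv ?_
    norm_num
    ring
  have hderiv : deriv f = fun x => deriv U x + (α - CV) * x := funext fun x => (hd1 x).deriv
  have hd2 : ∀ x, HasDerivAt (deriv f) (deriv (deriv U) x + (α - CV)) x := fun x => by
    rw [hderiv]
    refine ((hUd' x).hasDerivAt.add ((hasDerivAt_id x).const_mul (α - CV))).congr_deriv ?_
    ring
  have hconv : ConvexOn ℝ Set.univ f := by
    refine convexOn_univ_of_deriv2_nonneg (fun x => (hd1 x).differentiableAt)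
      (fun x => (hd2 x).differentiableAt) fun x => ?_
    have h2 : iteratedDeriv 2 U x = deriv (deriv U) x := by
      rw [iteratedDeriv_succ, iteratedDeriv_one]
    have := h.U_deriv2_inf.1 ⟨x, rfl⟩
    rw [h2] at this
    change 0 ≤ deriv (deriv f) x
    rw [(hd2 x).deriv]
    linarith
  refine ⟨deriv f 0, f 0, fun x => ?_⟩
  have htan : f 0 + deriv f 0 * x ≤ f x := by
    have h0 := (hd1 0).differentiableAt.hasDerivAt
    rcases lt_trichotomy x 0 with hx | rfl | hx
    · have := hconv.slope_le_of_hasDerivAt (Set.mem_univ x) (Set.mem_univ 0) hx h0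
      rw [slope_def_field, div_le_iff₀ (by linarith)] at this
      linarith
    · simp
    · have := hconv.le_slope_of_hasDerivAt (Set.mem_univ 0) (Set.mem_univ x) hx h0
      rw [slope_def_field, le_div_iff₀ (by linarith)] at this
      linarith
  rw [h.V_eq x]
  have : f x = U x + (α - CV) / 2 * x ^ 2 := rfl
  linarith

/-- An invariant density has Gaussian tails. -/
theorem IsInvariantDensity.exists_le_gaussian {W V U p : ℝ → ℝ} {α CW CV : ℝ}
    (h : IsPotentialPair W V U α CW CV) (hp : IsInvariantDensity W V p) :
    ∃ k C : ℝ, 0 < k ∧ 0 ≤ C ∧ ∀ x, |p x| ≤ C * Real.exp (-k * x ^ 2) := by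
  obtain ⟨b, d, hV⟩ := h.exists_le_V
  have hCV := h.CV_pos
  have hZ : 0 ≤ (∫ y, gibbsWeight W V p y)⁻¹ :=
    inv_nonneg.2 (integral_nonneg fun y => (Real.exp_pos _).le)
  refine ⟨CV / 2, (∫ y, gibbsWeight W V p y)⁻¹ * Real.exp (2 * b ^ 2 / CV - 2 * d), by positivity,
    by positivity, fun x => ?_⟩
  rw [abs_of_nonneg (hp.nonneg x), hp.eq_gibbs x, mul_assoc]
  refine mul_le_mul_of_nonneg_left ?_ hZ
  rw [gibbsWeight, ← Real.exp_add]
  refine Real.exp_le_exp.2 ?_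
  have hconv : 0 ≤ ∫ y, W (x - y) * p y :=
    integral_nonneg fun y => mul_nonneg (h.W_nonneg _) (hp.nonneg y)
  have hsq : -(CV / 2) * x ^ 2 - 2 * b * x ≤ 2 * b ^ 2 / CV := by
    rw [le_div_iff₀ hCV]
    nlinarith [sq_nonneg (CV * x + 2 * b)]
  linarith [hV x]

/-! ### Fourier transforms of functions with Gaussian tails. -/

section Gaussian

variable {φ : ℝ → ℝ} {k C : ℝ}

theorem norm_exp_mul_le (z : ℂ) (x : ℝ) :
    ‖Complex.exp (Complex.I * z * (x : ℂ))‖ ≤ Real.exp (‖z‖ * |x|) := by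
  refine (Complex.norm_exp_le_exp_norm _).trans_eq ?_
  simp

/-- Half of the Gaussian absorbs the exponential by completing the square; the other half keeps the
integrand integrable. -/
theorem exp_mul_abs_mul_gaussian_le (hk : 0 < k) (t x : ℝ) :
    Real.exp (t * |x|) * Real.exp (-k * x ^ 2) ≤
      Real.exp (1 / (2 * k) * t ^ 2) * Real.exp (-(k / 2) * x ^ 2) := by
  rw [← Real.exp_add, ← Real.exp_add]
  refine Real.exp_le_exp.2 ?_
  have : t * |x| - k / 2 * x ^ 2 ≤ 1 / (2 * k) * t ^ 2 := by
    rw [one_div, inv_mul_eq_div, le_div_iff₀ (by positivity), ← sq_abs x]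
    nlinarith [sq_nonneg (t - k * |x|)]
  linarith

theorem norm_exp_mul_mul_le (hk : 0 < k) (hC : 0 ≤ C) (hφ : ∀ x, |φ x| ≤ C * Real.exp (-k * x ^ 2))
    {z : ℂ} {t : ℝ} (hz : ‖z‖ ≤ t) (x : ℝ) :
    ‖Complex.exp (Complex.I * z * (x : ℂ)) * ((φ x : ℝ) : ℂ)‖ ≤
      Real.exp (1 / (2 * k) * t ^ 2) * (C * Real.exp (-(k / 2) * x ^ 2)) := by
  rw [norm_mul, Complex.norm_real, Real.norm_eq_abs]
  calc _ ≤ Real.exp (t * |x|) * (C * Real.exp (-k * x ^ 2)) := by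
        refine mul_le_mul ((norm_exp_mul_le z x).trans (Real.exp_le_exp.2 ?_)) (hφ x)
          (abs_nonneg _) (Real.exp_pos _).le
        gcongr
    _ = C * (Real.exp (t * |x|) * Real.exp (-k * x ^ 2)) := by ring
    _ ≤ C * (Real.exp (1 / (2 * k) * t ^ 2) * Real.exp (-(k / 2) * x ^ 2)) :=
        mul_le_mul_of_nonneg_left (exp_mul_abs_mul_gaussian_le hk t x) hC
    _ = _ := by ring

theorem integrable_gaussian_bound (hk : 0 < k) (c : ℝ) :
    Integrable fun x : ℝ => c * (C * Real.exp (-(k / 2) * x ^ 2)) :=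
  ((integrable_exp_neg_mul_sq (by positivity)).const_mul C).const_mul c

theorem aestronglyMeasurable_exp_mul (hm : Integrable φ) (z : ℂ) :
    AEStronglyMeasurable
      (fun x : ℝ => Complex.exp (Complex.I * z * (x : ℂ)) * ((φ x : ℝ) : ℂ)) :=
  (by fun_prop : Continuous fun x : ℝ =>
    Complex.exp (Complex.I * z * (x : ℂ))).aestronglyMeasurable.mul hm.ofReal.aestronglyMeasurable

theorem norm_fourierC_le (hk : 0 < k) (hC : 0 ≤ C) (hφ : ∀ x, |φ x| ≤ C * Real.exp (-k * x ^ 2))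
    (z : ℂ) : ‖fourierC φ z‖ ≤ Real.exp (1 / (2 * k) * ‖z‖ ^ 2 +
      C * ∫ x : ℝ, Real.exp (-(k / 2) * x ^ 2)) := by
  calc ‖fourierC φ z‖
      ≤ ∫ x : ℝ, Real.exp (1 / (2 * k) * ‖z‖ ^ 2) * (C * Real.exp (-(k / 2) * x ^ 2)) :=
        norm_integral_le_of_norm_le (integrable_gaussian_bound hk _)
          (Eventually.of_forall (norm_exp_mul_mul_le hk hC hφ le_rfl))
    _ = Real.exp (1 / (2 * k) * ‖z‖ ^ 2) * (C * ∫ x : ℝ, Real.exp (-(k / 2) * x ^ 2)) := by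
        rw [integral_const_mul, integral_const_mul]
    _ ≤ _ := by
        rw [Real.exp_add]
        refine mul_le_mul_of_nonneg_left ?_ (Real.exp_pos _).le
        linarith [Real.add_one_le_exp (C * ∫ x : ℝ, Real.exp (-(k / 2) * x ^ 2))]

/-- The Fourier transform of an integrable function with Gaussian tails is entire. -/
theorem differentiable_fourierC (hm : Integrable φ) (hk : 0 < k) (hC : 0 ≤ C)
    (hφ : ∀ x, |φ x| ≤ C * Real.exp (-k * x ^ 2)) : Differentiable ℂ (fourierC φ) := by
  intro z₀
  have hmain := hasDerivAt_integral_of_dominated_loc_of_deriv_le (μ := volume) (𝕜 := ℂ)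
    (F := fun (z : ℂ) (x : ℝ) => Complex.exp (Complex.I * z * (x : ℂ)) * ((φ x : ℝ) : ℂ))
    (F' := fun (z : ℂ) (x : ℝ) =>
      Complex.I * x * (Complex.exp (Complex.I * z * (x : ℂ)) * ((φ x : ℝ) : ℂ)))
    (x₀ := z₀) (s := Metric.ball z₀ 1)
    (bound := fun x => Real.exp (1 / (2 * k) * (‖z₀‖ + 2) ^ 2) *
      (C * Real.exp (-(k / 2) * x ^ 2)))
    (Metric.ball_mem_nhds z₀ one_pos)
    (Eventually.of_forall fun z => aestronglyMeasurable_exp_mul hm z)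
    ((integrable_gaussian_bound hk _).mono' (aestronglyMeasurable_exp_mul hm z₀)
      (Eventually.of_forall (norm_exp_mul_mul_le hk hC hφ le_rfl)))
    ((by fun_prop : Continuous fun x : ℝ => Complex.I * (x : ℂ)).aestronglyMeasurable.mul
      (aestronglyMeasurable_exp_mul hm z₀))
    (Eventually.of_forall fun x z hz => ?_) (integrable_gaussian_bound hk _)
    (Eventually.of_forall fun x z _ => ?_)
  · exact hmain.2.differentiableAt
  · have hzn : ‖z‖ ≤ ‖z₀‖ + 1 := by
      have h1 : ‖z - z₀‖ < 1 := by simpa [dist_eq_norm] using hz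
      linarith [norm_le_norm_add_norm_sub' z z₀]
    -- The factor `x` from differentiation is absorbed by raising the exponent `‖z₀‖ + 1` to `‖z₀‖ +
    -- 2`.
    have hx : |x| ≤ Real.exp |x| := by linarith [Real.add_one_le_exp |x|]
    rw [norm_mul, norm_mul, norm_mul, Complex.norm_I, one_mul, Complex.norm_real,
      Complex.norm_real, Real.norm_eq_abs, Real.norm_eq_abs]
    calc _ ≤ Real.exp |x| * (Real.exp ((‖z₀‖ + 1) * |x|) * (C * Real.exp (-k * x ^ 2))) := by
          refine mul_le_mul hx ?_ (by positivity) (Real.exp_pos _).le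
          refine mul_le_mul ((norm_exp_mul_le z x).trans (Real.exp_le_exp.2 ?_)) (hφ x)
            (abs_nonneg _) (Real.exp_pos _).le
          gcongr
      _ = C * (Real.exp ((‖z₀‖ + 2) * |x|) * Real.exp (-k * x ^ 2)) := by
          rw [show (‖z₀‖ + 2) * |x| = |x| + (‖z₀‖ + 1) * |x| by ring, Real.exp_add]
          ring
      _ ≤ C * (Real.exp (1 / (2 * k) * (‖z₀‖ + 2) ^ 2) * Real.exp (-(k / 2) * x ^ 2)) :=
          mul_le_mul_of_nonneg_left (exp_mul_abs_mul_gaussian_le hk _ x) hC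
      _ = _ := by ring
  · have h1 : HasDerivAt (fun z : ℂ => Complex.I * z * (x : ℂ)) (Complex.I * x) z := by
      simpa using ((hasDerivAt_id z).const_mul Complex.I).mul_const (x : ℂ)
    refine (h1.cexp.mul_const _).congr_deriv ?_
    ring

end Gaussian

/-! ### The quotient on the real line. -/

theorem fourierC_zero (φ : ℝ → ℝ) : fourierC φ 0 = ((∫ x, φ x : ℝ) : ℂ) := by
  simp [fourierC, integral_complex_ofReal]

theorem norm_exp_I_mul_ofReal_mul (y x : ℝ) :
    ‖Complex.exp (Complex.I * (y : ℂ) * (x : ℂ))‖ = 1 := by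
  rw [show Complex.I * (y : ℂ) * (x : ℂ) = ((y * x : ℝ) : ℂ) * Complex.I by push_cast; ring,
    Complex.norm_exp_ofReal_mul_I]

theorem mem_horizontalLine_zero {z : ℂ} : z ∈ horizontalLine 0 ↔ ∃ y : ℝ, (y : ℂ) = z := by
  simp [horizontalLine]

theorem integrable_exp_mul_of_mem_horizontalLine_zero {φ : ℝ → ℝ} (hφ : Integrable φ) {z : ℂ}
    (hz : z ∈ horizontalLine 0) :
    Integrable fun x : ℝ => Complex.exp (Complex.I * z * (x : ℂ)) * ((φ x : ℝ) : ℂ) := by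
  obtain ⟨y, rfl⟩ := mem_horizontalLine_zero.1 hz
  refine hφ.norm.mono' (aestronglyMeasurable_exp_mul hφ _) (Eventually.of_forall fun x => ?_)
  rw [norm_mul, norm_exp_I_mul_ofReal_mul, one_mul, Complex.norm_real]

theorem continuous_fourierC_ofReal {φ : ℝ → ℝ} (hφ : Integrable φ) :
    Continuous fun y : ℝ => fourierC φ (y : ℂ) := by
  refine continuous_of_dominated (bound := fun x => ‖φ x‖)
    (fun y => aestronglyMeasurable_exp_mul hφ _)
    (fun y => Eventually.of_forall fun x => ?_) hφ.norm
    (Eventually.of_forall fun x => by fun_prop)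
  rw [norm_mul, norm_exp_I_mul_ofReal_mul, one_mul, Complex.norm_real]

theorem tendsto_ofReal_cocompact_inf_horizontalLine :
    Tendsto (fun y : ℝ => (y : ℂ)) (cocompact ℝ) (cocompact ℂ ⊓ 𝓟 (horizontalLine 0)) :=
  tendsto_inf.2 ⟨Complex.isometry_ofReal.isClosedEmbedding.tendsto_cocompact,
    tendsto_principal.2 (Eventually.of_forall fun y => mem_horizontalLine_zero.2 ⟨y, rfl⟩)⟩

/-- On the real line, a numerator decaying faster than the Gaussian lower bound of a zero-free
denominator gives a square integrable quotient. -/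
theorem quotientSquareIntegrableOn_zero {f g : ℂ → ℂ} (hf : Continuous fun y : ℝ => f y)
    (hg : Continuous fun y : ℝ => g y) {c K : ℝ} (hK : 0 < K)
    (hlow : ∀ y : ℝ, K * Real.exp (-c * ‖(y : ℂ)‖ ^ 2) ≤ ‖g y‖) {s : ℝ≥0 → ℝ}
    (hs : (c : EReal) < liminf (fun t : ℝ≥0 => (s t : EReal)) atTop)
    (hO : f =O[cocompact ℂ ⊓ 𝓟 (horizontalLine 0)]
      fun z => Real.exp (-(‖z‖ ^ 2 * s ‖z‖₊))) :
    QuotientSquareIntegrableOn f g 0 := by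
  have hg0 : ∀ y : ℝ, g y ≠ 0 := fun y =>
    norm_pos_iff.1 (lt_of_lt_of_le (mul_pos hK (Real.exp_pos _)) (hlow y))
  simp only [QuotientSquareIntegrableOn, Complex.ofReal_zero, mul_zero, add_zero]
  refine ⟨Eventually.of_forall hg0, ?_⟩
  -- The gap `c' - c` is the Gaussian rate left to the quotient; squaring doubles it.
  obtain ⟨c', hcc', hc's⟩ := EReal.lt_iff_exists_real_btwn.1 hs
  have hcc' : c < c' := EReal.coe_lt_coe_iff.1 hcc'
  have hev : ∀ᶠ t : ℝ≥0 in atTop, c' < s t :=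
    (eventually_lt_of_lt_liminf hc's).mono fun t ht => EReal.coe_lt_coe_iff.1 ht
  have hnn : Tendsto (fun y : ℝ => ‖(y : ℂ)‖₊) (cocompact ℝ) atTop := by
    rw [← NNReal.tendsto_coe_atTop]
    simpa only [coe_nnnorm, Complex.norm_real] using tendsto_norm_cocompact_atTop (E := ℝ)
  obtain ⟨C, hC, hCb⟩ := (hO.comp_tendsto tendsto_ofReal_cocompact_inf_horizontalLine).exists_pos
  have hbig : (fun y : ℝ => ‖f y / g y‖ ^ 2) =O[cocompact ℝ]
      fun y : ℝ => Real.exp (-(2 * (c' - c)) * y ^ 2) := by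
    refine IsBigO.of_bound ((C / K) ^ 2) ?_
    filter_upwards [hCb.bound, hnn.eventually hev] with y h1 h2
    simp only [Function.comp_apply, Real.norm_eq_abs, Real.abs_exp, Complex.norm_real,
      sq_abs] at h1
    have hl := hlow y
    simp only [Complex.norm_real, Real.norm_eq_abs, sq_abs] at hl
    have hq : ‖f y / g y‖ ≤ C / K * Real.exp (-(c' - c) * y ^ 2) := by
      rw [norm_div, div_le_iff₀ (norm_pos_iff.2 (hg0 y))]
      calc ‖f y‖ ≤ C * Real.exp (-(y ^ 2 * s ‖(y : ℂ)‖₊)) := h1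
        _ ≤ C * Real.exp (-c' * y ^ 2) := by
            gcongr
            nlinarith [sq_nonneg y]
        _ = C / K * Real.exp (-(c' - c) * y ^ 2) * (K * Real.exp (-c * y ^ 2)) := by
            rw [show -c' * y ^ 2 = -(c' - c) * y ^ 2 + -c * y ^ 2 by ring, Real.exp_add]
            field_simp
        _ ≤ _ := by gcongr
    rw [Real.norm_of_nonneg (by positivity), Real.norm_of_nonneg (by positivity)]
    calc ‖f y / g y‖ ^ 2 ≤ (C / K * Real.exp (-(c' - c) * y ^ 2)) ^ 2 := by gcongr
      _ = _ := by
        rw [mul_pow, ← Real.exp_nat_mul]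
        congr 2
        push_cast
        ring
  -- The decay estimate holds only near infinity; continuity handles compact sets.
  have hcont : Continuous fun y : ℝ => ‖f y / g y‖ ^ 2 := ((hf.div hg hg0).norm).pow 2
  exact hcont.locallyIntegrable.integrable_of_isBigO_cocompact hbig
    ((integrable_exp_neg_mul_sq (by linarith)).integrableAtFilter _)

end McKeanVlasov

theorem corollary5p4 (W V U p : ℝ → ℝ) (α CW CV : ℝ)
    (hWV : IsPotentialPair W V U α CW CV) (hp : IsInvariantDensity W V p) :
    -- constants and radii with the Gaussian lower bound exist
    (∀ η : ℝ, 0 < η →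
      ∃ c : ℝ, GaussianLowerBound (fourierC p) c fun j => η * ‖zeroOf (fourierC p) j‖) ∧
    (ExponentCondition (fourierC p) →
      ∀ τ : ℝ, convergenceExponent (fourierC p) < (τ : EReal) → τ ≤ 2 →
        ∃ c : ℝ, GaussianLowerBound (fourierC p) c fun j => 1 / ‖zeroOf (fourierC p) j‖ ^ τ) ∧
    -- for all such constants and radii
    (∀ (c : ℝ) (ε : ZeroIndex (fourierC p) → ℝ), GaussianLowerBound (fourierC p) c ε →
      zeroDiscs (fourierC p) ε ∩ horizontalLine 0 = ∅ →
      ∀ s : ℝ≥0 → ℝ, IsSlowlyVarying s →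
        (c : EReal) < liminf (fun t : ℝ≥0 => (s t : EReal)) atTop →
        (fourierC (deriv W) =O[cocompact ℂ ⊓ 𝓟 (horizontalLine 0)]
          fun z => Real.exp (-(‖z‖ ^ 2 * s ‖z‖₊))) →
        (∀ z ∈ horizontalLine 0, fourierC p z ≠ 0) ∧
        QuotientSquareIntegrableOn (fourierC (deriv W)) (fourierC p) 0 ∧
        TransformCondition W p 0) := by
  obtain ⟨k, C, hk, hC, hpb⟩ := hp.exists_le_gaussian hWV
  have hf := differentiable_fourierC hp.integrable hk hC hpb
  have h0 : fourierC p 0 = 1 := by rw [fourierC_zero, hp.integral_eq_one, Complex.ofReal_one]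
  have hA : 0 < 1 / (2 * k) := by positivity
  have hgrowth := norm_fourierC_le hk hC hpb
  refine ⟨fun η hη => exists_gaussianLowerBound_const_mul_norm hf h0 hA hgrowth hη,
    fun _ τ hτ hτ2 => exists_gaussianLowerBound_rpow_norm hf h0 hA hgrowth hτ hτ2,
    fun c ε hcε hdisj s _ hs hO => ?_⟩
  obtain ⟨K, hK, hbound⟩ := hcε.bound
  have hline : ∀ z ∈ horizontalLine 0, K * Real.exp (-c * ‖z‖ ^ 2) ≤ ‖fourierC p z‖ :=
    fun z hz => hbound z fun hz' => (hdisj ▸ ⟨hz', hz⟩ : z ∈ (∅ : Set ℂ))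
  have hquot : QuotientSquareIntegrableOn (fourierC (deriv W)) (fourierC p) 0 :=
    quotientSquareIntegrableOn_zero (continuous_fourierC_ofReal hWV.W_deriv_integrable)
      (continuous_fourierC_ofReal hp.integrable) hK
      (fun y => hline y (mem_horizontalLine_zero.2 ⟨y, rfl⟩)) hs hO
  refine ⟨fun z hz => norm_pos_iff.1
    (lt_of_lt_of_le (mul_pos hK (Real.exp_pos _)) (hline z hz)), hquot, le_rfl, fun z hz => ?_,
    hquot, by rwa [neg_zero]⟩
  rw [neg_zero, Set.union_self] at hz
  exact ⟨integrable_exp_mul_of_mem_horizontalLine_zero hWV.W_deriv_integrable hz,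
    integrable_exp_mul_of_mem_horizontalLine_zero hp.integrable hz⟩
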